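/- Let $1\le k\le n$, and let $X_1,\dots,X_n$ be mutually independent non-negative random variables with finite expectations, whose cumulative distribution functions $x\mapsto \Pr[X_i\le x]$ are continuous on $\mathbb{R}$. An adaptive probing policy is a function $P$ that assigns to every state $(\kappa,r,T)$, where $\kappa\ge 1$ is the remaining number of probes, $r$ is the largest value sampled so far and $T\subseteq\{1,\dots,n\}$ is the set of rewards not probed yet ($T \neq \emptyset$), the next reward $P(\kappa,r,T)\in T$ to be probed, depending measurably on $r$. Its expected maximum reward from a state is given by $\mathcal{A}_P(0,r,T)=r$ and \[ \mathcal{A}_P(\kappa,r,T)=\mathbb{E}\bigl[\mathcal{A}_P(\kappa-1,\max\{r,X_i\},T\setminus\{i\})\bigr],\qquad i=P(\kappa,r,T),\ \kappa\ge 1 . \] Let $\mathcal{A}^*=\sup_P \mathcal{A}_P(k,0,\{1,\dots,n\})$ be the adaptive optimum. For $S\subseteq\{1,\dots,n\}$ with $S\ne\emptyset$ let $M(S)=\max_{i\in S}X_i$, and let $\mathcal{S}^*=\max_{|S|=k}\mathbb{E}[M(S)]$ be the static optimum. Then $\mathcal{A}^*$ is finite, $\mathcal{S}^*>0$, and \[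 \frac{\mathcal{A}^*}{\mathcal{S}^*}\le\frac{e}{e-1}. \] Equivalently, there is a set $\tilde S\subseteq\{1,\dots,n\}$ with $|\tilde S|=k$ and $\mathbb{E}[M(\tilde S)]\ge\bigl(1-\tfrac1e\bigr)\mathcal{A}^*$. -/

import Mathlib

open MeasureTheory ProbabilityTheory

/-- An adaptive probing policy for rewards indexed by `Fin n`.  In a state `(κ, r, T)`, where `κ` is
the remaining number of probes, `r` is the largest value sampled so far and `T` is the set of rewards
that have not been probed yet, it picks the next reward to be probed, out of `T`.  Its decision
depends measurably on `r`. -/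
structure ProbingPolicy (n : ℕ) where
  /-- the reward probed in state `(κ, r, T)` -/
  next : ℕ → ℝ → Finset (Fin n) → Fin n
  next_mem : ∀ (κ : ℕ) (r : ℝ) (T : Finset (Fin n)), 1 ≤ κ → T.Nonempty → next κ r T ∈ T
  measurable_next : ∀ (κ : ℕ) (T : Finset (Fin n)), Measurable fun r : ℝ => next κ r T

/-- `policyValue X μ P κ r T` is the expected maximum reward attained by the policy `P` when started
in state `(κ, r, T)`: probing `i = P(κ, r, T)` leads to the state
`(κ - 1, max {r, X i}, T \ {i})`, and `r` is collected once no probes remain. -/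
noncomputable def policyValue {Ω : Type*} [MeasurableSpace Ω] {n : ℕ}
    (X : Fin n → Ω → ℝ) (μ : Measure Ω) (P : ProbingPolicy n) :
    ℕ → ℝ → Finset (Fin n) → ℝ
  | 0, r, _ => r
  | κ + 1, r, T =>
      ∫ ω, policyValue X μ P κ (max r (X (P.next (κ + 1) r T) ω))
        (T.erase (P.next (κ + 1) r T)) ∂μ

/-- The expected maximum reward of the policy `P` with `k` probes, from the initial state
in which no reward has been collected and all rewards are available. -/
noncomputable def expectedReward {Ω : Type*} [MeasurableSpace Ω] {n : ℕ}
    (X : Fin n → Ω → ℝ) (μ : Measure Ω) (k : ℕ) (P : ProbingPolicy n) : ℝ :=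
  policyValue X μ P k 0 Finset.univ

/-- The adaptive optimum: the supremum of the expected maximum reward over all adaptive policies. -/
noncomputable def adaptiveOpt {Ω : Type*} [MeasurableSpace Ω] {n : ℕ}
    (X : Fin n → Ω → ℝ) (μ : Measure Ω) (k : ℕ) : ℝ :=
  ⨆ P : ProbingPolicy n, expectedReward X μ k P

/-- The random maximum `M(S) = max_{i ∈ S} X i` over a finite set `S` (which is `0` for `S = ∅`). -/
noncomputable def maxReward {Ω : Type*} {n : ℕ} (X : Fin n → Ω → ℝ) (S : Finset (Fin n)) (ω : Ω) :
    ℝ :=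
  if h : S.Nonempty then S.sup' h (fun i => X i ω) else 0

/-- The static optimum: the maximum of `E[M(S)]` over the sets `S` of cardinality exactly `k`. -/
noncomputable def staticOpt {Ω : Type*} [MeasurableSpace Ω] {n : ℕ}
    (X : Fin n → Ω → ℝ) (μ : Measure Ω) (k : ℕ) : ℝ :=
  ⨆ S : {S : Finset (Fin n) // S.card = k}, ∫ ω, maxReward X S.1 ω ∂μ

/-! For any threshold t ≥ 0, one probe of `X i` raises max(r, t) by at most E[(X i - t)⁺] on
average. Hence every adaptive policy is worth at most φ(t) = t + the largest total mean excess of k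
rewards (`policyValue_le`).

Choose t to minimize φ. The subgradient condition yields optimal sets whose expected numbers of
rewards above t are at least 1 and at most 1 (`exists_balanced_threshold`). Exchanging elements one
at a time between them gives two optimal sets C ∪ {i}, C ∪ {j} and a mixture with expected number
exactly 1 (`exists_exchange_mixture`).

For s ≥ t let Q(s) ≤ 1 be the mixture's expected number above s. By independence its maximum exceeds
s with probability at least 1 - exp(-Q(s)) ≥ (1 - 1/e) Q(s). Integrating over s > t, and adding t
times the bound at t, gives (1 - 1/e) φ(t) (`mixture_integral_maxReward_ge`); one of the two sets
does at least as well as the mixture. -/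

/-- The mean excess `E[(Y - t)⁺]` of a random variable over a threshold. -/
noncomputable def meanExcess {Ω : Type*} [MeasurableSpace Ω] (Y : Ω → ℝ) (μ : Measure Ω) (t : ℝ) :
    ℝ :=
  ∫ ω, max (Y ω - t) 0 ∂μ

/-- The tail probability `Pr[Y > t]` of a random variable. -/
noncomputable def tailProb {Ω : Type*} [MeasurableSpace Ω] (Y : Ω → ℝ) (μ : Measure Ω) (t : ℝ) :
    ℝ :=
  μ.real {ω | t < Y ω}

/-! ### Mean excess and tail of a single random variable. -/

section SingleVariable

variable {Ω : Type*} [MeasurableSpace Ω] {μ : Measure Ω} {Y : Ω → ℝ}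

lemma meanExcess_nonneg (t : ℝ) : 0 ≤ meanExcess Y μ t :=
  integral_nonneg fun _ => le_max_right _ _

lemma tailProb_nonneg (t : ℝ) : 0 ≤ tailProb Y μ t := measureReal_nonneg

/-- The distribution function vanishes on the negatives, so by continuity at 0 as well: there is no
atom at 0. -/
lemma measureReal_le_zero_eq_zero (h0 : ∀ᵐ ω ∂μ, 0 ≤ Y ω)
    (hc : Continuous fun x : ℝ => μ.real {ω | Y ω ≤ x}) : μ.real {ω | Y ω ≤ 0} = 0 := by
  have hneg : ∀ x : ℝ, x < 0 → μ.real {ω | Y ω ≤ x} = 0 := by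
    intro x hx
    rw [measureReal_def, ENNReal.toReal_eq_zero_iff]
    left
    refine measure_mono_null (fun ω hω => ?_) (ae_iff.1 h0)
    simp only [Set.mem_ofPred_eq] at hω ⊢
    linarith
  have h1 : Filter.Tendsto (fun x : ℝ => μ.real {ω | Y ω ≤ x}) (nhdsWithin 0 (Set.Iio 0))
      (nhds (μ.real {ω | Y ω ≤ 0})) := (hc.tendsto 0).mono_left nhdsWithin_le_nhds
  have h2 : Filter.Tendsto (fun x : ℝ => μ.real {ω | Y ω ≤ x}) (nhdsWithin 0 (Set.Iio 0))
      (nhds 0) := by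
    refine tendsto_const_nhds.congr' ?_
    filter_upwards [self_mem_nhdsWithin] with x hx
    exact (hneg x hx).symm
  exact tendsto_nhds_unique h1 h2

variable [IsProbabilityMeasure μ]

lemma integrable_excess (hY : Integrable Y μ) (t : ℝ) :
    Integrable (fun ω => max (Y ω - t) 0) μ :=
  (hY.sub (integrable_const t)).pos_part

lemma tailProb_le_one (t : ℝ) : tailProb Y μ t ≤ 1 := measureReal_le_one

lemma tailProb_antitone : Antitone (tailProb Y μ) := fun _ _ hst =>
  measureReal_mono fun _ hω => lt_of_le_of_lt hst hω

lemma tailProb_eq_one_sub (hm : Measurable Y) (t : ℝ) :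
    tailProb Y μ t = 1 - μ.real {ω | Y ω ≤ t} := by
  rw [← probReal_compl_eq_one_sub (measurableSet_le hm measurable_const), tailProb]
  congr 1
  ext ω
  simp

/-- The number `-tailProb Y μ a` is a subgradient of the mean excess at `a`. -/
lemma meanExcess_sub_le (hm : Measurable Y) (hY : Integrable Y μ) (a b : ℝ) :
    meanExcess Y μ a - meanExcess Y μ b ≤ (b - a) * tailProb Y μ a := by
  have hms : MeasurableSet {ω | a < Y ω} := measurableSet_lt measurable_const hm
  have hind : ∫ ω, Set.indicator {ω | a < Y ω} (fun _ => b - a) ω ∂μ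
      = (b - a) * tailProb Y μ a := by
    rw [integral_indicator_const _ hms, smul_eq_mul, mul_comm, tailProb]
  rw [← hind, meanExcess, meanExcess,
    ← integral_sub (integrable_excess hY a) (integrable_excess hY b)]
  refine integral_mono ((integrable_excess hY a).sub (integrable_excess hY b))
    ((integrable_const _).indicator hms) fun ω => ?_
  by_cases hω : a < Y ω
  · have h1 : max (Y ω - a) 0 = Y ω - a := max_eq_left (by linarith)
    have h2 := le_max_left (Y ω - b) 0
    simp only [Set.indicator, Set.mem_ofPred_eq, hω, if_true, h1]
    linarith
  · have h1 : max (Y ω - a) 0 = 0 := max_eq_right (by linarith)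
    have h2 := le_max_right (Y ω - b) 0
    simp only [Set.indicator, Set.mem_ofPred_eq, hω, if_false, h1]
    linarith

lemma continuous_meanExcess (hm : Measurable Y) (hY : Integrable Y μ) :
    Continuous (meanExcess Y μ) := by
  refine (LipschitzWith.of_le_add fun a b => ?_).continuous
  have h := meanExcess_sub_le (μ := μ) hm hY a b
  have h2 : (b - a) * tailProb Y μ a ≤ |b - a| :=
    (mul_le_mul_of_nonneg_right (le_abs_self _) (tailProb_nonneg a)).trans
      (mul_le_of_le_one_right (abs_nonneg _) (tailProb_le_one a))
  rw [Real.dist_eq, abs_sub_comm]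
  linarith

/-- The layer-cake formula; it reduces comparisons of mean excesses to pointwise comparisons of
tails. -/
lemma meanExcess_eq_integral_tailProb (hY : Integrable Y μ) (t : ℝ) :
    meanExcess Y μ t = ∫ s in Set.Ioi (0 : ℝ), tailProb Y μ (t + s) := by
  rw [meanExcess, (integrable_excess hY t).integral_eq_integral_meas_lt
    (Filter.Eventually.of_forall fun _ => le_max_right _ _)]
  refine setIntegral_congr_fun measurableSet_Ioi fun s hs => ?_
  have hs : (0 : ℝ) < s := hs
  simp only [tailProb]
  congr 1
  ext ω
  simp only [Set.mem_ofPred_eq, lt_max_iff]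
  constructor
  · rintro (h | h) <;> linarith
  · intro h
    left
    linarith

lemma integrableOn_tailProb (hY : Integrable Y μ) (t : ℝ) :
    IntegrableOn (fun s => tailProb Y μ (t + s)) (Set.Ioi 0) := by
  refine ⟨((tailProb_antitone.comp_monotone
    (monotone_id.const_add t)).measurable).aestronglyMeasurable, ?_⟩
  have hI := integrable_excess hY t
  have h0 : 0 ≤ᵐ[μ] fun ω => max (Y ω - t) 0 :=
    Filter.Eventually.of_forall fun _ => le_max_right _ _
  rw [hasFiniteIntegral_iff_ofReal (Filter.Eventually.of_forall fun _ => tailProb_nonneg _)]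
  refine lt_of_le_of_lt ?_ ((hasFiniteIntegral_iff_ofReal h0).1 hI.2)
  rw [lintegral_eq_lintegral_meas_lt μ h0 hI.1.aemeasurable]
  refine setLIntegral_mono' measurableSet_Ioi fun s hs => ?_
  rw [tailProb, ofReal_measureReal]
  refine measure_mono fun ω hω => ?_
  simp only [Set.mem_ofPred_eq, lt_max_iff] at hω ⊢
  left
  linarith

/-- A non-negative variable collects at least `t` on `{t < Y}`, plus its excess over `t`. -/
lemma mul_tailProb_add_meanExcess_le (hm : Measurable Y) (hY : Integrable Y μ)
    (h0 : ∀ᵐ ω ∂μ, 0 ≤ Y ω) (t : ℝ) :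
    t * tailProb Y μ t + meanExcess Y μ t ≤ ∫ ω, Y ω ∂μ := by
  have hms : MeasurableSet {ω | t < Y ω} := measurableSet_lt measurable_const hm
  have hind : ∫ ω, Set.indicator {ω | t < Y ω} (fun _ => t) ω ∂μ = t * tailProb Y μ t := by
    rw [integral_indicator_const _ hms, smul_eq_mul, mul_comm, tailProb]
  have hi : Integrable (Set.indicator {ω | t < Y ω} (fun _ => t)) μ :=
    (integrable_const _).indicator hms
  rw [← hind, meanExcess, ← integral_add hi (integrable_excess hY t)]
  refine integral_mono_ae (hi.add (integrable_excess hY t)) hY ?_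
  filter_upwards [h0] with ω hω
  by_cases h : t < Y ω
  · simp only [Set.indicator, Set.mem_ofPred_eq, h, if_true]
    rw [max_eq_left (by linarith)]
    linarith
  · simp only [Set.indicator, Set.mem_ofPred_eq, h, if_false]
    rw [max_eq_right (by linarith)]
    linarith

/-- The effect of one probe on max(r, t), by a pointwise bound; the gain does not depend on r. -/
lemma integral_max_le (hY : Integrable Y μ) (r t : ℝ) :
    Integrable (fun ω => max (max r (Y ω)) t) μ ∧
      ∫ ω, max (max r (Y ω)) t ∂μ ≤ max r t + meanExcess Y μ t := by
  have h1 : Integrable (fun ω => max (max r (Y ω)) t) μ :=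
    ((integrable_const r).sup hY).sup (integrable_const t)
  refine ⟨h1, ?_⟩
  have h2 : ∫ ω, (max r t + max (Y ω - t) 0) ∂μ = max r t + meanExcess Y μ t := by
    rw [integral_add (integrable_const _) (integrable_excess hY t)]
    simp [meanExcess]
  rw [← h2]
  refine integral_mono h1 ((integrable_const _).add (integrable_excess hY t)) fun ω => ?_
  have a1 := le_max_left r t
  have a2 := le_max_right r t
  have a3 := le_max_left (Y ω - t) 0
  have a4 := le_max_right (Y ω - t) 0
  exact max_le (max_le (by linarith) (by linarith)) (by linarith)

lemma integral_pos_of_continuous_cdf (hY : Integrable Y μ) (h0 : ∀ᵐ ω ∂μ, 0 ≤ Y ω)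
    (hc : Continuous fun x : ℝ => μ.real {ω | Y ω ≤ x}) : 0 < ∫ ω, Y ω ∂μ := by
  refine lt_of_le_of_ne (integral_nonneg_of_ae h0) fun h => ?_
  have h1 := (integral_eq_zero_iff_of_nonneg_ae h0 hY).1 h.symm
  have h2 : μ.real {ω | Y ω ≤ 0} = 1 := by
    have h3 : {ω | Y ω ≤ 0} =ᵐ[μ] Set.univ := by
      refine Filter.eventuallyEq_univ.2 ?_
      filter_upwards [h1] with ω hω
      exact hω.le
    rw [measureReal_congr h3, probReal_univ]
  rw [measureReal_le_zero_eq_zero h0 hc] at h2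
  norm_num at h2

end SingleVariable

/-! ### Exchanges between optimal sets of size k. -/

section Exchange

open Finset

/-- If two maximizers of a linear weight `h` among the sets of size `k` have `q`-weights on the two
sides of `1`, then there are two such maximizers that differ by at most one exchange and of which a
convex combination has `q`-weight `1`. -/
lemma exists_exchange_mixture {α : Type*} [DecidableEq α] (h q : α → ℝ) {k : ℕ} (hk : 1 ≤ k) {B : ℝ}
    (hB : ∀ S : Finset α, S.card = k → ∑ i ∈ S, h i ≤ B) (S' : Finset α) (hS'k : S'.card = k)
    (hS' : ∑ i ∈ S', h i = B) (hq' : ∑ i ∈ S', q i ≤ 1) (m : ℕ) (S : Finset α)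
    (hm : (S \ S').card = m) (hSk : S.card = k)
    (hS : ∑ i ∈ S, h i = B) (hq : 1 ≤ ∑ i ∈ S, q i) :
    ∃ (C : Finset α) (i j : α) (a : ℝ), i ∉ C ∧ j ∉ C ∧ C.card + 1 = k ∧ 0 ≤ a ∧ a ≤ 1 ∧
      ∑ l ∈ C, h l + h i = B ∧ ∑ l ∈ C, h l + h j = B ∧
      ∑ l ∈ C, q l + (a * q i + (1 - a) * q j) = 1 := by
  induction m generalizing S with
  | zero =>
    have hsub : S ⊆ S' := by rwa [card_eq_zero, sdiff_eq_empty_iff_subset] at hm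
    obtain rfl : S = S' := eq_of_subset_of_card_le hsub (by omega)
    obtain ⟨i, hi⟩ : S.Nonempty := card_pos.1 (by omega)
    refine ⟨S.erase i, i, i, 1, notMem_erase _ _, notMem_erase _ _, ?_, by norm_num, le_refl _,
      ?_, ?_, ?_⟩
    · rw [card_erase_add_one hi, hSk]
    · rw [sum_erase_add _ _ hi, hS]
    · rw [sum_erase_add _ _ hi, hS]
    · have := sum_erase_add S q hi
      linarith
  | succ m ih =>
    obtain ⟨i, hi⟩ : (S \ S').Nonempty := card_pos.1 (by omega)
    have hcard : (S' \ S).card = m + 1 := by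
      have h1 := card_sdiff_add_card_inter S S'
      have h2 := card_sdiff_add_card_inter S' S
      rw [inter_comm] at h2
      omega
    obtain ⟨j, hj⟩ : (S' \ S).Nonempty := card_pos.1 (by omega)
    rw [mem_sdiff] at hi hj
    have hjC : j ∉ S.erase i := fun hc => hj.2 (mem_of_mem_erase hc)
    have hiC' : i ∉ S'.erase j := fun hc => hi.2 (mem_of_mem_erase hc)
    have hkS : (insert j (S.erase i)).card = k := by
      rw [card_insert_of_notMem hjC, card_erase_add_one hi.1, hSk]
    have hkS' : (insert i (S'.erase j)).card = k := by
      rw [card_insert_of_notMem hiC', card_erase_add_one hj.1, hS'k]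
    have e1 := sum_erase_add S h hi.1
    have e2 := sum_erase_add S' h hj.1
    -- The two exchanged sets have total weight 2B and each weighs at most B, so both are optimal.
    have b1 := hB _ hkS
    have b2 := hB _ hkS'
    rw [sum_insert hjC] at b1
    rw [sum_insert hiC'] at b2
    have hopt : ∑ l ∈ S.erase i, h l + h j = B := by linarith
    have eq1 := sum_erase_add S q hi.1
    -- Either the exchanged set is still on the upper side and closer to `S'`, or this very exchange
    -- crosses 1 and `a` solves a linear equation.
    by_cases hQ : 1 ≤ ∑ l ∈ insert j (S.erase i), q l
    · refine ih _ ?_ hkS (by rw [sum_insert hjC]; linarith) hQ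
      have : insert j (S.erase i) \ S' = (S \ S').erase i := by
        rw [insert_sdiff_of_mem _ hj.1, erase_sdiff_comm]
      rw [this, card_erase_of_mem (mem_sdiff.2 hi)]
      omega
    · rw [sum_insert hjC] at hQ
      push Not at hQ
      set c := ∑ l ∈ S.erase i, q l
      have hd : 0 < q i - q j := by linarith
      refine ⟨S.erase i, i, j, (1 - c - q j) / (q i - q j), notMem_erase _ _, hjC, ?_, ?_, ?_,
        by linarith, hopt, ?_⟩
      · rw [card_erase_add_one hi.1, hSk]
      · exact div_nonneg (by linarith) hd.le
      · rw [div_le_one hd]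
        linarith
      · field_simp
        ring

end Exchange

/-- On [-1, 0] the convex exponential lies below its chord. -/
lemma mul_le_one_sub_exp_neg {x : ℝ} (h0 : 0 ≤ x) (h1 : x ≤ 1) :
    (1 - 1 / Real.exp 1) * x ≤ 1 - Real.exp (-x) := by
  have h := convexOn_exp.2 (Set.mem_univ 0) (Set.mem_univ (-1)) (sub_nonneg.2 h1) h0 (by ring)
  simp only [smul_eq_mul, mul_zero, zero_add, mul_neg, mul_one, Real.exp_zero] at h
  rw [Real.exp_neg 1] at h
  rw [one_div]
  linarith

/-! ### Adaptive upper bound and static lower bound. -/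

section Rewards

lemma maxReward_of_nonempty {Ω : Type*} {n : ℕ} {X : Fin n → Ω → ℝ}
    {S : Finset (Fin n)} (hS : S.Nonempty) (ω : Ω) :
    maxReward X S ω = S.sup' hS fun i => X i ω := by
  simp [maxReward, hS]

variable {Ω : Type*} [MeasurableSpace Ω] {μ : Measure Ω} {n : ℕ} {X : Fin n → Ω → ℝ}

lemma maxReward_nonneg (hX_nonneg : ∀ i, ∀ᵐ ω ∂μ, 0 ≤ X i ω) {S : Finset (Fin n)}
    (hS : S.Nonempty) : ∀ᵐ ω ∂μ, 0 ≤ maxReward X S ω := by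
  filter_upwards [ae_all_iff.2 hX_nonneg] with ω hω
  obtain ⟨i, hi⟩ := hS
  rw [maxReward_of_nonempty ⟨i, hi⟩]
  exact (hω i).trans (Finset.le_sup' (fun i => X i ω) hi)

lemma measurable_maxReward (hX_meas : ∀ i, Measurable (X i)) {S : Finset (Fin n)}
    (hS : S.Nonempty) : Measurable (maxReward X S) := by
  have : maxReward X S = S.sup' hS X := by
    ext ω
    rw [maxReward_of_nonempty hS, Finset.sup'_apply]
  rw [this]
  exact Finset.measurable_sup' hS fun i _ => hX_meas i

lemma integrable_maxReward (hX_int : ∀ i, Integrable (X i) μ) {S : Finset (Fin n)}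
    (hS : S.Nonempty) : Integrable (maxReward X S) μ := by
  have : maxReward X S = S.sup' hS X := by
    ext ω
    rw [maxReward_of_nonempty hS, Finset.sup'_apply]
  rw [this]
  exact Finset.sup'_induction (p := fun f => Integrable f μ) hS X (fun _ hf _ hg => hf.sup hg) fun i _ => hX_int i

lemma policyValue_nonneg (P : ProbingPolicy n)
    (κ : ℕ) {r : ℝ} (hr : 0 ≤ r) (T : Finset (Fin n)) : 0 ≤ policyValue X μ P κ r T := by
  induction κ generalizing r T with
  | zero => simpa [policyValue] using hr
  | succ κ ih =>
    rw [policyValue]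
    exact integral_nonneg fun ω => ih (hr.trans (le_max_left _ _)) _

variable [IsProbabilityMeasure μ]

lemma tailProb_maxReward (hX_meas : ∀ i, Measurable (X i)) (hX_indep : iIndepFun X μ)
    {S : Finset (Fin n)} (hS : S.Nonempty) (t : ℝ) :
    tailProb (maxReward X S) μ t = 1 - ∏ i ∈ S, (1 - tailProb (X i) μ t) := by
  rw [tailProb_eq_one_sub (measurable_maxReward hX_meas hS)]
  congr 1
  have h := hX_indep.measure_inter_preimage_eq_mul S (sets := fun _ => Set.Iic t)
    fun _ _ => measurableSet_Iic
  have hset : {ω | maxReward X S ω ≤ t} = ⋂ i ∈ S, X i ⁻¹' Set.Iic t := by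
    ext ω
    simp [maxReward_of_nonempty hS]
  rw [hset, measureReal_def, h, ENNReal.toReal_prod]
  refine Finset.prod_congr rfl fun i _ => ?_
  rw [tailProb_eq_one_sub (hX_meas i), sub_sub_cancel]
  rfl

/-- Every adaptive policy gains at most `max r t` plus the largest total mean excess over `t` of
`κ` of the available rewards. -/
lemma policyValue_le (hX_int : ∀ i, Integrable (X i) μ)
    (P : ProbingPolicy n) (t : ℝ) (κ : ℕ) {r : ℝ} (hr : 0 ≤ r) (T : Finset (Fin n))
    (hT : κ ≤ T.card) (B : ℝ)
    (hB : ∀ S ⊆ T, S.card = κ → ∑ i ∈ S, meanExcess (X i) μ t ≤ B) :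
    policyValue X μ P κ r T ≤ max r t + B := by
  induction κ generalizing r T B with
  | zero =>
    have := hB ∅ (Finset.empty_subset _) rfl
    have := le_max_left r t
    simp only [policyValue, Finset.sum_empty] at *
    linarith
  | succ κ ih =>
    rw [policyValue]
    have hi := P.next_mem (κ + 1) r T (by omega) (Finset.card_pos.1 (by omega))
    set i := P.next (κ + 1) r T
    obtain ⟨hint, hle⟩ := integral_max_le (hX_int i) r t
    -- The probed reward `i` uses up its own mean excess of the budget `B`: a set admissible
    -- afterwards becomes admissible before on inserting `i`.
    have hbound : ∀ ω, policyValue X μ P κ (max r (X i ω)) (T.erase i)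
        ≤ max (max r (X i ω)) t + (B - meanExcess (X i) μ t) := by
      intro ω
      refine ih (hr.trans (le_max_left _ _)) _ ?_ _ fun S hS hSk => ?_
      · rw [Finset.card_erase_of_mem hi]
        omega
      · have hiS : i ∉ S := fun h => Finset.notMem_erase i T (hS h)
        have := hB (insert i S)
          (Finset.insert_subset hi (hS.trans (Finset.erase_subset _ _)))
          (by rw [Finset.card_insert_of_notMem hiS, hSk])
        rw [Finset.sum_insert hiS] at this
        linarith
    calc _ ≤ ∫ ω, (max (max r (X i ω)) t + (B - meanExcess (X i) μ t)) ∂μ :=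
          -- This form asks for integrability of the upper bound only, not of the policy value.
          integral_mono_of_nonneg
            (Filter.Eventually.of_forall fun ω =>
              policyValue_nonneg P κ (hr.trans (le_max_left _ _)) _)
            (hint.add (integrable_const _)) (Filter.Eventually.of_forall hbound)
      _ = ∫ ω, max (max r (X i ω)) t ∂μ + (B - meanExcess (X i) μ t) := by
          rw [integral_add hint (integrable_const _)]
          simp
      _ ≤ max r t + B := by linarith

/-- A mixture of two sets that differ by one exchange, with expected number of rewards above `t`
equal to `1`, collects a `1 - 1/e` fraction of `t` plus its total mean excess. -/
lemma mixture_integral_maxReward_ge (hX_meas : ∀ i, Measurable (X i))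
    (hX_nonneg : ∀ i, ∀ᵐ ω ∂μ, 0 ≤ X i ω) (hX_int : ∀ i, Integrable (X i) μ)
    (hX_indep : iIndepFun X μ) {C : Finset (Fin n)} {i j : Fin n} (hi : i ∉ C) (hj : j ∉ C)
    {a t : ℝ} (ha0 : 0 ≤ a) (ha1 : a ≤ 1) (ht : 0 ≤ t)
    (hq : ∑ l ∈ C, tailProb (X l) μ t
      + (a * tailProb (X i) μ t + (1 - a) * tailProb (X j) μ t) = 1) :
    (1 - 1 / Real.exp 1) * (t + (∑ l ∈ C, meanExcess (X l) μ t
      + (a * meanExcess (X i) μ t + (1 - a) * meanExcess (X j) μ t)))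
      ≤ a * ∫ ω, maxReward X (insert i C) ω ∂μ
        + (1 - a) * ∫ ω, maxReward X (insert j C) ω ∂μ := by
  have hni : (insert i C).Nonempty := Finset.insert_nonempty _ _
  have hnj : (insert j C).Nonempty := Finset.insert_nonempty _ _
  have hb0 : 0 ≤ 1 - a := by linarith
  set Q : ℝ → ℝ := fun s => ∑ l ∈ C, tailProb (X l) μ s
      + (a * tailProb (X i) μ s + (1 - a) * tailProb (X j) μ s) with hQdef
  set U : ℝ → ℝ := fun s => a * tailProb (maxReward X (insert i C)) μ s
      + (1 - a) * tailProb (maxReward X (insert j C)) μ s with hUdef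
  have hQt : Q t = 1 := hq
  have hQ0 : ∀ s, 0 ≤ Q s := fun s =>
    add_nonneg (Finset.sum_nonneg fun _ _ => tailProb_nonneg _)
      (add_nonneg (mul_nonneg ha0 (tailProb_nonneg _)) (mul_nonneg hb0 (tailProb_nonneg _)))
  have hQanti : Antitone Q := fun s u hsu =>
    add_le_add (Finset.sum_le_sum fun _ _ => tailProb_antitone hsu)
      (add_le_add (mul_le_mul_of_nonneg_left (tailProb_antitone hsu) ha0)
        (mul_le_mul_of_nonneg_left (tailProb_antitone hsu) hb0))
  have hUQ : ∀ s, t ≤ s → (1 - 1 / Real.exp 1) * Q s ≤ U s := by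
    intro s hs
    refine (mul_le_one_sub_exp_neg (hQ0 s) (hQt ▸ hQanti hs)).trans ?_
    simp only [hUdef, tailProb_maxReward hX_meas hX_indep hni,
      tailProb_maxReward hX_meas hX_indep hnj, Finset.prod_insert hi, Finset.prod_insert hj]
    set p := ∏ l ∈ C, (1 - tailProb (X l) μ s) with hp
    -- As the two sets differ in one element, the mixture behaves like C with one further reward of
    -- tail `x`: the failure probability is linear in `a`. For sets further apart, convexity of exp
    -- would work against the bound.
    set x := a * tailProb (X i) μ s + (1 - a) * tailProb (X j) μ s with hx
    have hp0 : 0 ≤ p := Finset.prod_nonneg fun l _ => sub_nonneg.2 (tailProb_le_one s)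
    have hpe : p ≤ Real.exp (-∑ l ∈ C, tailProb (X l) μ s) := by
      rw [← Finset.sum_neg_distrib, Real.exp_sum]
      exact Finset.prod_le_prod (fun l _ => sub_nonneg.2 (tailProb_le_one s))
        fun l _ => Real.one_sub_le_exp_neg _
    have hkey : (1 - x) * p ≤ Real.exp (-Q s) := by
      have : -Q s = -x + -∑ l ∈ C, tailProb (X l) μ s := by
        simp only [hQdef, hx]
        ring
      rw [this, Real.exp_add]
      exact mul_le_mul (Real.one_sub_le_exp_neg x) hpe hp0 (Real.exp_pos _).le
    have hxp : (1 - x) * p = a * ((1 - tailProb (X i) μ s) * p)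
        + (1 - a) * ((1 - tailProb (X j) μ s) * p) := by
      rw [hx]
      ring
    linarith
  have hIX : ∀ l, IntegrableOn (fun s => tailProb (X l) μ (t + s)) (Set.Ioi 0) := fun l =>
    integrableOn_tailProb (hX_int l) t
  have hIC : IntegrableOn (fun s => ∑ l ∈ C, tailProb (X l) μ (t + s)) (Set.Ioi 0) :=
    integrable_finsetSum _ fun l _ => hIX l
  have hIm : IntegrableOn (fun s => a * tailProb (X i) μ (t + s)
      + (1 - a) * tailProb (X j) μ (t + s)) (Set.Ioi 0) :=
    ((hIX i).const_mul a).add ((hIX j).const_mul (1 - a))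
  have hIi := integrableOn_tailProb (integrable_maxReward hX_int hni) t
  have hIj := integrableOn_tailProb (integrable_maxReward hX_int hnj) t
  have hQint : ∫ s in Set.Ioi (0 : ℝ), Q (t + s) = ∑ l ∈ C, meanExcess (X l) μ t
      + (a * meanExcess (X i) μ t + (1 - a) * meanExcess (X j) μ t) := by
    simp only [hQdef]
    rw [integral_add hIC hIm, integral_finsetSum _ fun l _ => hIX l,
      integral_add ((hIX i).const_mul a) ((hIX j).const_mul (1 - a)), integral_const_mul,
      integral_const_mul]
    simp only [meanExcess_eq_integral_tailProb (hX_int _)]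
  have hUint : ∫ s in Set.Ioi (0 : ℝ), U (t + s) = a * meanExcess (maxReward X (insert i C)) μ t
      + (1 - a) * meanExcess (maxReward X (insert j C)) μ t := by
    simp only [hUdef]
    rw [integral_add (hIi.const_mul a) (hIj.const_mul (1 - a)), integral_const_mul,
      integral_const_mul, ← meanExcess_eq_integral_tailProb (integrable_maxReward hX_int hni),
      ← meanExcess_eq_integral_tailProb (integrable_maxReward hX_int hnj)]
  have hmain : (1 - 1 / Real.exp 1) * ∫ s in Set.Ioi (0 : ℝ), Q (t + s)
      ≤ ∫ s in Set.Ioi (0 : ℝ), U (t + s) := by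
    rw [← integral_const_mul]
    refine setIntegral_mono_on ((hIC.add hIm).const_mul _)
      ((hIi.const_mul a).add (hIj.const_mul (1 - a))) measurableSet_Ioi fun s hs => ?_
    have hs : (0 : ℝ) < s := hs
    exact hUQ _ (by linarith)
  -- The tail bound at t itself accounts for the summand t.
  have hUt := mul_le_mul_of_nonneg_left (hUQ t le_rfl) ht
  rw [hQt, mul_one] at hUt
  rw [hQint, hUint] at hmain
  have hi' := mul_le_mul_of_nonneg_left (mul_tailProb_add_meanExcess_le
    (measurable_maxReward hX_meas hni) (integrable_maxReward hX_int hni)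
    (maxReward_nonneg hX_nonneg hni) t) ha0
  have hj' := mul_le_mul_of_nonneg_left (mul_tailProb_add_meanExcess_le
    (measurable_maxReward hX_meas hnj) (integrable_maxReward hX_int hnj)
    (maxReward_nonneg hX_nonneg hnj) t) hb0
  simp only [hUdef] at hUt
  linarith

/-- At a minimizer `t` over `[0, ∞)` of `t` plus the largest total mean excess over `t` of `k`
rewards, there are optimal sets whose expected numbers of rewards above `t` are at least and at
most `1`. -/
lemma exists_balanced_threshold {k : ℕ} (hk : 1 ≤ k) (hkn : k ≤ n)
    (hX_meas : ∀ i, Measurable (X i))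
    (hX_nonneg : ∀ i, ∀ᵐ ω ∂μ, 0 ≤ X i ω) (hX_int : ∀ i, Integrable (X i) μ)
    (hX_cont : ∀ i, Continuous fun x : ℝ => μ.real {ω | X i ω ≤ x}) :
    ∃ t B : ℝ, 0 ≤ t ∧
      (∀ S : Finset (Fin n), S.card = k → ∑ i ∈ S, meanExcess (X i) μ t ≤ B) ∧
      (∃ S : Finset (Fin n), S.card = k ∧ ∑ i ∈ S, meanExcess (X i) μ t = B ∧
        1 ≤ ∑ i ∈ S, tailProb (X i) μ t) ∧
      ∃ S : Finset (Fin n), S.card = k ∧ ∑ i ∈ S, meanExcess (X i) μ t = B ∧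
        ∑ i ∈ S, tailProb (X i) μ t ≤ 1 := by
  set F : Finset (Finset (Fin n)) := Finset.powersetCard k Finset.univ with hF
  have hFmem : ∀ S, S ∈ F ↔ S.card = k := fun S => by simp [hF, Finset.mem_powersetCard]
  have hFne : F.Nonempty := Finset.powersetCard_nonempty.2 (by simpa using hkn)
  set g : Finset (Fin n) → ℝ → ℝ := fun S t => t + ∑ i ∈ S, meanExcess (X i) μ t with hg
  have hgc : ∀ S, Continuous (g S) := fun S =>
    continuous_id.add (continuous_finsetSum _ fun i _ => continuous_meanExcess (hX_meas i) (hX_int i))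
  have hqc : ∀ S : Finset (Fin n), Continuous fun t => ∑ i ∈ S, tailProb (X i) μ t := by
    intro S
    refine continuous_finsetSum _ fun i _ => ?_
    have : tailProb (X i) μ = fun t => 1 - μ.real {ω | X i ω ≤ t} :=
      funext fun t => tailProb_eq_one_sub (hX_meas i) t
    rw [this]
    exact continuous_const.sub (hX_cont i)
  have hgsub : ∀ S a b, g S a - g S b ≤ (b - a) * (∑ i ∈ S, tailProb (X i) μ a - 1) := by
    intro S a b
    have : ∑ i ∈ S, meanExcess (X i) μ a - ∑ i ∈ S, meanExcess (X i) μ b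
        ≤ (b - a) * ∑ i ∈ S, tailProb (X i) μ a := by
      rw [← Finset.sum_sub_distrib, Finset.mul_sum]
      exact Finset.sum_le_sum fun i _ => meanExcess_sub_le (hX_meas i) (hX_int i) a b
    simp only [hg]
    linarith
  set φ : ℝ → ℝ := fun t => F.sup' hFne fun S => g S t with hφ
  have hφc : Continuous φ := Continuous.finset_sup'_apply hFne fun S _ => hgc S
  have hgφ : ∀ S ∈ F, ∀ t, g S t ≤ φ t := fun S hS t => Finset.le_sup' (fun S => g S t) hS
  have htφ : ∀ t, t ≤ φ t := by
    intro t
    obtain ⟨S, hS⟩ := hFne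
    refine le_trans ?_ (hgφ S hS t)
    have := Finset.sum_nonneg fun i (_ : i ∈ S) => meanExcess_nonneg (Y := X i) (μ := μ) t
    simp only [hg]
    linarith
  -- Since φ(s) ≥ s, a minimizer over [0, φ(0)] is one over [0, ∞).
  obtain ⟨t, ⟨ht0, -⟩, htmin⟩ := isCompact_Icc.exists_isMinOn
    (Set.nonempty_Icc.2 (htφ 0)) hφc.continuousOn
  have hmin : ∀ s, 0 ≤ s → φ t ≤ φ s := by
    intro s hs
    by_cases hsφ : s ≤ φ 0
    · exact htmin ⟨hs, hsφ⟩
    · exact (htmin ⟨le_rfl, htφ 0⟩).trans ((not_le.1 hsφ).le.trans (htφ s))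
  have hopt : ∀ S, g S t = φ t → ∑ i ∈ S, meanExcess (X i) μ t = φ t - t := by
    intro S hS
    simp only [hg] at hS
    linarith
  -- near `t`, the value `φ t` is only attained by optimal sets on the non-decreasing side
  have hstrict : ∀ l : Filter ℝ, l ≤ nhds t → l.NeBot → (∀ᶠ s in l, 0 ≤ s) →
      ∃ S ∈ F, g S t = φ t ∧ ¬ ∀ᶠ s in l, g S s < g S t := by
    intro l hl hne hpos
    by_contra! hcon
    -- Non-optimal sets stay below φ(t) near t by continuity; if all optimal ones dropped too,
    -- finiteness would give φ(s) < φ(t).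
    have hall : ∀ᶠ s in l, ∀ S ∈ F, g S s < φ t := by
      rw [Filter.eventually_all_finset]
      intro S hS
      rcases (hgφ S hS t).lt_or_eq with h | h
      · exact hl ((hgc S).tendsto t |>.eventually_lt_const h)
      · have := hcon S hS h
        rwa [h] at this
    obtain ⟨s, hs0, hs⟩ := (hpos.and hall).exists
    exact absurd (hmin s hs0) (not_le.2 ((Finset.sup'_lt_iff hFne).2 hs))
  refine ⟨t, φ t - t, ht0, fun S hS => ?_, ?_, ?_⟩
  · have := hgφ S ((hFmem S).2 hS) t
    simp only [hg] at this
    linarith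
  -- At t = 0 no left neighbour is available, but all tails equal 1 there, so the sum is k ≥ 1.
  · rcases ht0.eq_or_lt with h0 | hpos
    · obtain ⟨S, hS, hSφ⟩ := Finset.exists_mem_eq_sup' hFne fun S => g S t
      refine ⟨S, (hFmem S).1 hS, hopt S hSφ.symm, ?_⟩
      have : ∀ i ∈ S, tailProb (X i) μ t = 1 := fun i _ => by
        rw [tailProb_eq_one_sub (hX_meas i), ← h0,
          measureReal_le_zero_eq_zero (hX_nonneg i) (hX_cont i), sub_zero]
      rw [Finset.sum_congr rfl this, Finset.sum_const, (hFmem S).1 hS]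
      simpa using hk
    · obtain ⟨S, hS, hSφ, hev⟩ := hstrict (nhdsWithin t (Set.Iio t)) nhdsWithin_le_nhds
        inferInstance (nhdsWithin_le_nhds (lt_mem_nhds hpos |>.mono fun s hs => le_of_lt hs))
      refine ⟨S, (hFmem S).1 hS, hopt S hSφ, ?_⟩
      by_contra! hlt
      refine hev ?_
      -- By continuity the tail sum is below 1 also at s, so the subgradient at s forces `g S s < g
      -- S t`.
      filter_upwards [nhdsWithin_le_nhds ((hqc S).tendsto t |>.eventually_lt_const hlt),
        self_mem_nhdsWithin] with s hs hst
      have hst : s < t := hst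
      have := hgsub S s t
      nlinarith
  · obtain ⟨S, hS, hSφ, hev⟩ := hstrict (nhdsWithin t (Set.Ioi t)) nhdsWithin_le_nhds
      inferInstance (by
        filter_upwards [self_mem_nhdsWithin] with s hs
        exact ht0.trans (le_of_lt hs))
    refine ⟨S, (hFmem S).1 hS, hopt S hSφ, ?_⟩
    by_contra! hlt
    refine hev ?_
    filter_upwards [nhdsWithin_le_nhds ((hqc S).tendsto t |>.eventually_const_lt hlt),
      self_mem_nhdsWithin] with s hs hst
    have hst : t < s := hst
    have := hgsub S s t
    nlinarith

/-- There are a set of `k` rewards and a bound on all adaptive policies of which the expected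
maximum over the set is at least a `1 - 1/e` fraction. -/
lemma exists_card_eq_integral_maxReward_ge {k : ℕ} (hk : 1 ≤ k) (hkn : k ≤ n)
    (hX_meas : ∀ i, Measurable (X i))
    (hX_nonneg : ∀ i, ∀ᵐ ω ∂μ, 0 ≤ X i ω) (hX_int : ∀ i, Integrable (X i) μ)
    (hX_indep : iIndepFun X μ)
    (hX_cont : ∀ i, Continuous fun x : ℝ => μ.real {ω | X i ω ≤ x}) :
    ∃ (S : Finset (Fin n)) (V : ℝ), S.card = k ∧ 0 ≤ V ∧
      (∀ P : ProbingPolicy n, expectedReward X μ k P ≤ V) ∧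
      (1 - 1 / Real.exp 1) * V ≤ ∫ ω, maxReward X S ω ∂μ := by
  obtain ⟨t, B, ht, hB, ⟨S, hSk, hS, hSq⟩, S', hSk', hS', hSq'⟩ :=
    exists_balanced_threshold hk hkn hX_meas hX_nonneg hX_int hX_cont
  obtain ⟨C, i, j, a, hi, hj, hCk, ha0, ha1, hhi, hhj, hq⟩ :=
    exists_exchange_mixture _ _ hk hB S' hSk' hS' hSq' _ S rfl hSk hS hSq
  have hmix := mixture_integral_maxReward_ge hX_meas hX_nonneg hX_int hX_indep hi hj ha0 ha1 ht hq
  have hval : ∑ l ∈ C, meanExcess (X l) μ t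
      + (a * meanExcess (X i) μ t + (1 - a) * meanExcess (X j) μ t) = B := by
    linear_combination a * hhi + (1 - a) * hhj
  rw [hval] at hmix
  have hB0 : 0 ≤ B := hS ▸ Finset.sum_nonneg fun l _ => meanExcess_nonneg t
  have hP : ∀ P : ProbingPolicy n, expectedReward X μ k P ≤ t + B := by
    intro P
    have := policyValue_le hX_int P t k le_rfl Finset.univ (by simpa using hkn) B
      fun S _ hS => hB S hS
    rwa [max_eq_right ht] at this
  by_cases hle : (1 - 1 / Real.exp 1) * (t + B) ≤ ∫ ω, maxReward X (insert i C) ω ∂μ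
  · exact ⟨_, t + B, by rw [Finset.card_insert_of_notMem hi, hCk], by linarith, hP, hle⟩
  · refine ⟨insert j C, t + B, by rw [Finset.card_insert_of_notMem hj, hCk], by linarith, hP, ?_⟩
    by_contra! hlt
    push Not at hle
    -- If both sets fell short, so would their mixture; for a = 0 only the second set counts.
    rcases ha0.eq_or_lt with rfl | hpos
    · linarith
    · nlinarith

lemma integral_maxReward_pos {S : Finset (Fin n)} (hS : S.Nonempty)
    (hX_nonneg : ∀ i, ∀ᵐ ω ∂μ, 0 ≤ X i ω) (hX_int : ∀ i, Integrable (X i) μ)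
    (hX_cont : ∀ i, Continuous fun x : ℝ => μ.real {ω | X i ω ≤ x}) :
    0 < ∫ ω, maxReward X S ω ∂μ := by
  obtain ⟨i, hi⟩ := hS
  refine (integral_pos_of_continuous_cdf (hX_int i) (hX_nonneg i) (hX_cont i)).trans_le
    (integral_mono (hX_int i) (integrable_maxReward hX_int ⟨i, hi⟩) fun ω => ?_)
  rw [maxReward_of_nonempty ⟨i, hi⟩]
  exact Finset.le_sup' (fun i => X i ω) hi

end Rewards

/-! ### The adaptivity gap. -/

theorem theorem3 {Ω : Type*} [MeasurableSpace Ω] (μ : Measure Ω) [IsProbabilityMeasure μ]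
    (n k : ℕ) (hk : 1 ≤ k) (hkn : k ≤ n)
    (X : Fin n → Ω → ℝ)
    (hX_meas : ∀ i, Measurable (X i))
    (hX_nonneg : ∀ i, ∀ᵐ ω ∂μ, 0 ≤ X i ω)
    (hX_int : ∀ i, Integrable (X i) μ)
    (hX_indep : iIndepFun X μ)
    (hX_cont : ∀ i, Continuous fun x : ℝ => μ.real {ω | X i ω ≤ x}) :
    BddAbove (Set.range fun P : ProbingPolicy n => expectedReward X μ k P) ∧
    0 < staticOpt X μ k ∧
    adaptiveOpt X μ k / staticOpt X μ k ≤ Real.exp 1 / (Real.exp 1 - 1) ∧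
    ∃ S : Finset (Fin n), S.card = k ∧
      (1 - 1 / Real.exp 1) * adaptiveOpt X μ k ≤ ∫ ω, maxReward X S ω ∂μ := by
  obtain ⟨S, V, hSk, hV0, hV, hSV⟩ := exists_card_eq_integral_maxReward_ge hk hkn hX_meas hX_nonneg
    hX_int hX_indep hX_cont
  -- The bound 0 ≤ V covers the convention that a real supremum over an empty family is 0.
  have hA : adaptiveOpt X μ k ≤ V := Real.iSup_le hV hV0
  have he : 1 < Real.exp 1 := Real.one_lt_exp_iff.2 one_pos
  have hc : 0 < 1 - 1 / Real.exp 1 := by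
    rw [sub_pos, div_lt_one (by linarith)]
    exact he
  have hSA : (1 - 1 / Real.exp 1) * adaptiveOpt X μ k ≤ ∫ ω, maxReward X S ω ∂μ :=
    (mul_le_mul_of_nonneg_left hA hc.le).trans hSV
  have hSO : ∫ ω, maxReward X S ω ∂μ ≤ staticOpt X μ k :=
    le_ciSup (f := fun S : {S : Finset (Fin n) // S.card = k} => ∫ ω, maxReward X S.1 ω ∂μ)
      (Set.finite_range _).bddAbove ⟨S, hSk⟩
  have hpos : 0 < staticOpt X μ k :=
    (integral_maxReward_pos (Finset.card_pos.1 (by omega)) hX_nonneg hX_int hX_cont).trans_le hSO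
  refine ⟨⟨V, by rintro _ ⟨P, rfl⟩; exact hV P⟩, hpos, ?_, S, hSk, hSA⟩
  rw [div_le_div_iff₀ hpos (by linarith)]
  have h := mul_le_mul_of_nonneg_left (hSA.trans hSO) (Real.exp_pos 1).le
  have h2 : Real.exp 1 * ((1 - 1 / Real.exp 1) * adaptiveOpt X μ k)
      = adaptiveOpt X μ k * (Real.exp 1 - 1) := by
    field_simp
  linarith
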